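/- Let $k$ be a field, let $Y$ be a scheme of finite type over $k$, and let $n\ge 0$ and $d$ be integers. Put $\square=\mathbb P^1_k\setminus\{1\}$ and $\square^n_Y=Y\times_k\square^n$ (with $\square^0=\operatorname{Spec} k$). A face of $\square^n_Y$ is a closed subscheme $Y\times F$, where $F\subset\square^n$ is given by equations $y_{i_1}=\epsilon_1,\dots,y_{i_s}=\epsilon_s$ with $i_1<\dots<i_s$ and $\epsilon_j\in\{0,\infty\}$ ($s=0$ is allowed). Let $\underline z_d(Y,n)$ be the free abelian group on the integral closed subschemes $Z\subset\square^n_Y$ of dimension $d+n$ that intersect every face $Y\times F$ properly, i.e. $\dim(Z\cap(Y\times F))\le\dim Z-\operatorname{codim}F$ for all $F$. Let $\underline z_d(Y,n)_{\rm degn}$ be the subgroup generated by the pull-backs of cycles in $\underline z_d(Y,n-1)$ along the projections $\square^n_Y\to\square^{n-1}_Y$ forgetting one coordinate (it is $0$ for $n=0$), and put $z_d(Y,n)=\underline z_d(Y,n)/\underline z_d(Y,n)_{\rm degn}$. For a closed subset $W\subset Y$ let $$G_d(W,n)=\ker\bigl(z_d(Y,n)\to z_d(Y\setminus W,n)\bigr),$$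 the kernel of the restriction of cycles; this is the group of cycles in $z_d(Y,n)$ supported over $W$. For $V\subset U$ open in $Y$ one has $G_d(Y\setminus U,n)\subset G_d(Y\setminus V,n)$. Consider the presheaf of abelian groups on $Y_{\rm Zar}$ $$\mathcal S_{n,d}:\ U\mapsto \frac{z_d(Y,n)}{G_d(Y\setminus U,n)},$$ whose restriction maps $\rho^U_V$ are the natural quotient maps. Then $\mathcal S_{n,d}$ is a flasque sheaf on $Y_{\rm Zar}$. Moreover, for any two open subsets $U,V\subset Y$ the sequence $$0\to\mathcal S_{n,d}(U\cup V)\xrightarrow{\ \delta_0\ }\mathcal S_{n,d}(U)\oplus\mathcal S_{n,d}(V)\xrightarrow{\ \delta_1\ }\mathcal S_{n,d}(U\cap V)\to0$$ is exact, where $\delta_0=(\rho^{U\cup V}_U,\rho^{U\cup V}_V)$ and $\delta_1(x_1,x_2)=\rho^U_{U\cap V}(x_1)-\rho^V_{U\cap V}(x_2)$. -/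

import Mathlib

open CategoryTheory Limits AlgebraicGeometry TopologicalSpace
universe u

/-! Preparations from dimension theory: for a scheme locally of finite type over a field, a non-empty
open subset of an irreducible closed subset has the same Krull dimension. This is needed for the
restriction of cycles to open subschemes to be well defined. -/

theorem ringKrullDim_eq_of_integral_injective {A B : Type*} [CommRing A] [CommRing B] [IsDomain B] [Algebra A B]
    [Algebra.IsIntegral A B] (h : Function.Injective (algebraMap A B)) :
    ringKrullDim A = ringKrullDim B := by
  apply le_antisymm
  · have : Algebra.HasGoingUp A B := inferInstance
    refine iSup_le fun l => ?_
    obtain ⟨Q, hQ, hc⟩ := Ideal.exists_ideal_over_prime_of_isIntegral_of_isDomain (S := B) l.head.asIdeal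
      (by rw [(RingHom.injective_iff_ker_eq_bot _).1 h]; exact bot_le)
    have : Q.LiesOver l.head.asIdeal := ⟨hc.symm⟩
    obtain ⟨L, hL, -⟩ := Ideal.exists_ltSeries_of_hasGoingUp l Q
    rw [← hL]
    exact le_iSup (fun l : LTSeries (PrimeSpectrum B) => ((l.length : ℕ∞) : WithBot ℕ∞)) L
  · refine Order.krullDim_le_of_strictMono (PrimeSpectrum.comap (algebraMap A B)) ?_
    intro p q hpq
    exact Ideal.IsIntegral.comap_lt_comap (R := A) (I := p.asIdeal) (J := q.asIdeal) hpq

theorem exists_ringKrullDim_eq (k A : Type u) [Field k] [CommRing A] [IsDomain A] [Algebra k A]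
    [Algebra.FiniteType k A] : ∃ s : ℕ, ringKrullDim A = s ∧ Algebra.trdeg k A = s := by
  obtain ⟨s, g, hi, hg⟩ := exists_integral_inj_algHom_of_fg k A
  refine ⟨s, ?_, ?_⟩
  · algebraize [g.toRingHom]
    rw [← ringKrullDim_eq_of_integral_injective (A := MvPolynomial (Fin s) k) (B := A) hi,
      MvPolynomial.ringKrullDim_of_isNoetherianRing]
    simp
  · algebraize [g.toRingHom]
    have : IsScalarTower k (MvPolynomial (Fin s) k) A := .of_algHom g
    have : FaithfulSMul (MvPolynomial (Fin s) k) A := (faithfulSMul_iff_algebraMap_injective _ _).2 hi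
    have h := lift_trdeg_add_eq (R := k) (S := MvPolynomial (Fin s) k) (A := A)
    have h2 : Algebra.trdeg (MvPolynomial (Fin s) k) A = 0 := trdeg_eq_zero
    rw [h2, MvPolynomial.trdeg_of_isDomain] at h
    simpa using h.symm

theorem trdeg_fractionRing (k A K : Type u) [Field k] [CommRing A] [IsDomain A] [Algebra k A]
    [Field K] [Algebra A K] [IsFractionRing A K] [Algebra k K] [IsScalarTower k A K] :
    Algebra.trdeg k K = Algebra.trdeg k A := by
  have : Algebra.IsAlgebraic A K := IsLocalization.isAlgebraic K (nonZeroDivisors A)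
  have : FaithfulSMul k A := inferInstance
  have h := trdeg_add_eq (R := k) (S := A) (A := K)
  rw [← h, show Algebra.trdeg A K = 0 from trdeg_eq_zero, add_zero]

theorem krullDim_le_of_cover {X : Type*} [TopologicalSpace X] (c : WithBot ℕ∞)
    (h : ∀ x : X, ∃ V : Opens X, x ∈ V ∧ topologicalKrullDim V ≤ c) : topologicalKrullDim X ≤ c := by
  refine iSup_le fun l => ?_
  obtain ⟨x, hx⟩ := l.head.isIrreducible.nonempty
  obtain ⟨V, hxV, hV⟩ := h x
  refine le_trans ?_ hV
  have hm (i) : x ∈ l i := (LTSeries.head_le l i) hx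
  let e := IrreducibleCloseds.orderIsoOfIsOpenEmbedding ((↑) : V → X) V.2.isOpenEmbedding_subtypeVal
  let L : LTSeries (IrreducibleCloseds V) :=
    { length := l.length
      toFun i := e.symm ⟨l i, ⟨⟨x, hxV⟩, hm i⟩⟩
      step i := e.symm.strictMono (l.step i) }
  exact le_iSup (fun l : LTSeries (IrreducibleCloseds V) => ((l.length : ℕ∞) : WithBot ℕ∞)) L

theorem krullDim_open_of_integral {k : Type u} [Field k] {X : Scheme.{u}} [IsIntegral X]
    (f : X ⟶ Spec (.of k)) [LocallyOfFiniteType f] (U : X.Opens) (hU : (U : Set X).Nonempty) :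
    topologicalKrullDim U = topologicalKrullDim X := by
  have key : ∃ s : ℕ, ∀ V : X.Opens, IsAffineOpen V → (V : Set X).Nonempty →
      topologicalKrullDim V = s := by
    let φ : CommRingCat.of k ⟶ Γ(X, ⊤) := (Scheme.ΓSpecIso (.of k)).inv ≫ f.appTop
    have aff : ∀ V : X.Opens, IsAffineOpen V → (V : Set X).Nonempty →
      ∃ s : ℕ, topologicalKrullDim V = s ∧
        @Algebra.trdeg k (X.functionField) _ _
          ((φ ≫ X.presheaf.germ ⊤ (genericPoint X) trivial).hom.toAlgebra) = s := by
      intro V hV hne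
      have : Nonempty V := hne.to_subtype
      let i := X.presheaf.map (homOfLE (le_top : V ≤ ⊤)).op
      algebraize [(φ ≫ i).hom, (φ ≫ X.presheaf.germ ⊤ (genericPoint X) trivial).hom]
      have ft : (φ ≫ i).hom.FiniteType := by
        have := LocallyOfFiniteType.finiteType_appLE f (U := ⊤) (isAffineOpen_top _) hV le_top
        have h2 : (φ ≫ i) = (Scheme.ΓSpecIso (.of k)).inv ≫ f.appLE ⊤ V le_top := by
          simp only [φ, i, Scheme.Hom.appLE, Category.assoc]; rfl
        rw [h2, CommRingCat.hom_comp]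
        exact this.comp (RingHom.FiniteType.of_surjective _
          (Scheme.ΓSpecIso (.of k)).commRingCatIsoToRingEquiv.symm.surjective)
      have : Algebra.FiniteType k Γ(X, V) := ft
      obtain ⟨s, h1, h2⟩ := exists_ringKrullDim_eq k Γ(X, V)
      have := functionField_isFractionRing_of_isAffineOpen X V hV
      refine ⟨s, ?_, ?_⟩
      · rw [← h1, ← PrimeSpectrum.topologicalKrullDim_eq_ringKrullDim]
        exact IsHomeomorph.topologicalKrullDim_eq _ (Scheme.homeoOfIso hV.isoSpec).isHomeomorph
      · have : IsScalarTower k Γ(X, V) X.functionField := by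
          refine .of_algebraMap_eq' ?_
          change (φ ≫ X.presheaf.germ ⊤ (genericPoint X) trivial).hom =
            ((φ ≫ i) ≫ X.germToFunctionField V).hom
          congr 1
          simp only [i, Scheme.germToFunctionField, Category.assoc, TopCat.Presheaf.germ_res]
        rw [← h2, trdeg_fractionRing k Γ(X, V) X.functionField]
    obtain ⟨_, ⟨V, hV, rfl⟩, hxV, -⟩ :=
      X.isBasis_affineOpens.exists_subset_of_mem_open (Set.mem_univ (genericPoint X)) isOpen_univ
    obtain ⟨s, -, hs⟩ := aff V hV ⟨_, hxV⟩
    refine ⟨s, fun W hW hW' => ?_⟩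
    obtain ⟨t, ht, ht'⟩ := aff W hW hW'
    rw [ht, Nat.cast_inj.1 (ht'.symm.trans hs)]
  obtain ⟨s, hs⟩ := key
  apply le_antisymm (topologicalKrullDim_subspace_le X U)
  have h1 : topologicalKrullDim X ≤ s := krullDim_le_of_cover _ fun x => by
    obtain ⟨_, ⟨V, hV, rfl⟩, hxV, -⟩ :=
      X.isBasis_affineOpens.exists_subset_of_mem_open (Set.mem_univ x) isOpen_univ
    exact ⟨V, hxV, (hs V hV ⟨x, hxV⟩).le⟩
  obtain ⟨x, hx⟩ := hU
  obtain ⟨_, ⟨V, hV, rfl⟩, hxV, hVU⟩ :=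
      X.isBasis_affineOpens.exists_subset_of_mem_open hx U.2
  refine h1.trans ?_
  rw [← hs V hV ⟨x, hxV⟩]
  exact (Topology.IsEmbedding.inclusion hVU).isInducing.topologicalKrullDim_le

theorem isReduced_vanishingIdeal {X : Scheme.{u}} (Z : Closeds X) :
    IsReduced (Scheme.IdealSheafData.vanishingIdeal Z).subscheme := by
  let I := Scheme.IdealSheafData.vanishingIdeal Z
  have (i : I.subschemeCover.openCover.I₀) : IsReduced (I.subschemeCover.openCover.X i) := by
    change IsReduced (Spec (CommRingCat.of (Γ(X, i.1) ⧸ I.ideal i)))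
    have : _root_.IsReduced (X.presheaf.obj (.op (show X.affineOpens from i).1) ⧸ I.ideal i) := by
      rw [← Ideal.isRadical_iff_quotient_reduced]
      exact PrimeSpectrum.isRadical_vanishingIdeal _
    infer_instance
  exact IsReduced.of_openCover _ I.subschemeCover.openCover

theorem krullDim_preimage {k : Type u} [Field k] {X X' : Scheme.{u}} (f : X ⟶ Spec (.of k))
    [LocallyOfFiniteType f] (j : X' ⟶ X) [IsOpenImmersion j] (Z : IrreducibleCloseds X)
    (h : (j ⁻¹' (Z : Set X)).Nonempty) :
    topologicalKrullDim (j ⁻¹' (Z : Set X)) = topologicalKrullDim (Z : Set X) := by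
  apply le_antisymm
  · exact (j.isOpenEmbedding.isInducing.restrictPreimage (Z : Set X)).topologicalKrullDim_le
  let I := Scheme.IdealSheafData.vanishingIdeal ⟨(Z : Set X), Z.isClosed⟩
  have hr : Set.range I.subschemeι = (Z : Set X) := by
    rw [Scheme.IdealSheafData.range_subschemeι]; rfl
  let e : I.subscheme ≃ₜ (Z : Set X) :=
    I.subschemeι.isEmbedding.toHomeomorph.trans (Homeomorph.setCongr hr)
  have : IsReduced I.subscheme := isReduced_vanishingIdeal _
  have hZ : IrreducibleSpace (Z : Set X) := Subtype.irreducibleSpace Z.isIrreducible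
  have : IrreducibleSpace I.subscheme := e.symm.surjective.irreducibleSpace e.symm.continuous
  have : IsIntegral I.subscheme := isIntegral_of_irreducibleSpace_of_isReduced _
  let U : I.subscheme.Opens := I.subschemeι ⁻¹ᵁ j.opensRange
  obtain ⟨x, hx⟩ := h
  have hU : (U : Set I.subscheme).Nonempty := by
    obtain ⟨y, hy⟩ := hr.ge hx
    exact ⟨y, x, hy.symm⟩
  have h1 := krullDim_open_of_integral (I.subschemeι ≫ f) U hU
  rw [← e.isHomeomorph.topologicalKrullDim_eq, ← h1]
  have hU' (y : U) : I.subschemeι y.1 ∈ Set.range j := y.2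
  let g : U → X' := fun y => j.isOpenEmbedding.isEmbedding.toHomeomorph.symm ⟨_, hU' y⟩
  have hg : ∀ y, j (g y) = I.subschemeι y.1 := fun y =>
    congrArg Subtype.val (j.isOpenEmbedding.isEmbedding.toHomeomorph.apply_symm_apply ⟨_, hU' y⟩)
  have hgi : Topology.IsInducing g := by
    refine .of_comp ?_ j.continuous ?_
    · exact j.isOpenEmbedding.isEmbedding.toHomeomorph.symm.continuous.comp
        ((I.subschemeι.continuous.comp continuous_subtype_val).subtype_mk _)
    · have hc : j ∘ g = fun y : U => I.subschemeι y.1 := funext hg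
      rw [hc]
      exact I.subschemeι.isEmbedding.isInducing.comp .subtypeVal
  have hgm (y) : g y ∈ j ⁻¹' (Z : Set X) := by
    change j (g y) ∈ (Z : Set X)
    rw [hg, ← hr]; exact ⟨_, rfl⟩
  exact (hgi.codRestrict hgm).topologicalKrullDim_le

/-! The cubes, admissible cycles, and the presheaf. -/

/-- The standard grading of `k[X₀, X₁]`. -/
abbrev stdGrading (k : Type u) [Field k] : ℕ → Submodule k (MvPolynomial (Fin 2) k) :=
  MvPolynomial.homogeneousSubmodule (Fin 2) k

noncomputable instance stdGradedAlgebra (k : Type u) [Field k] : GradedAlgebra (stdGrading k) :=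
  MvPolynomial.gradedAlgebra

/-- The structure morphism of the projective line `ℙ¹ = Proj k[X₀, X₁]` over `k`. -/
noncomputable def projLineStr (k : Type u) [Field k] : Proj (stdGrading k) ⟶ Spec (.of k) :=
  Proj.toSpecZero (stdGrading k) ≫
    Spec.map (CommRingCat.ofHom (algebraMap k (stdGrading k 0)))

/-- `□ = ℙ¹ ∖ {1}`, where the coordinate of `ℙ¹` is `y = X₀ / X₁`, so that `y = 1` is the
vanishing locus of `X₀ - X₁`. -/
noncomputable def box (k : Type u) [Field k] : (Proj (stdGrading k)).Opens :=
  Proj.basicOpen (stdGrading k) (MvPolynomial.X 0 - MvPolynomial.X 1)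

/-- The structure morphism of `□` over `k`. -/
noncomputable def boxStr (k : Type u) [Field k] : (box k).toScheme ⟶ Spec (.of k) :=
  (box k).ι ≫ projLineStr k

/-- The closed point `y = 0` (for `e = 0`, i.e. `X₀ = 0`) or `y = ∞` (for `e = 1`, i.e. `X₁ = 0`)
of `□`. -/
def boxEnd (k : Type u) [Field k] (e : Fin 2) : Set (box k).toScheme :=
  {p | (MvPolynomial.X e : MvPolynomial (Fin 2) k) ∈
    ProjectiveSpectrum.asHomogeneousIdeal ((box k).ι p)}

/-- `□ⁿ`, the `n`-fold fibre product of `□` over `k`; for `n = 0` it is `Spec k`. -/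
noncomputable abbrev cube (k : Type u) [Field k] (n : ℕ) : Scheme.{u} :=
  widePullback (Spec (.of k)) (fun _ : Fin n => (box k).toScheme) (fun _ => boxStr k)

/-- The structure morphism of `□ⁿ` over `k`. -/
noncomputable abbrev cubeStr (k : Type u) [Field k] (n : ℕ) : cube k n ⟶ Spec (.of k) :=
  WidePullback.base (fun _ : Fin n => boxStr k)

/-- `□ⁿ_Y = Y ×ₖ □ⁿ` for a `k`-scheme `f : Y ⟶ Spec k`. -/
noncomputable abbrev cubeOver {k : Type u} [Field k] {Y : Scheme.{u}} (f : Y ⟶ Spec (.of k))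
    (n : ℕ) : Scheme.{u} :=
  pullback f (cubeStr k n)

/-- The structure morphism of `□ⁿ_Y` over `k`. -/
noncomputable abbrev cubeOverStr {k : Type u} [Field k] {Y : Scheme.{u}} (f : Y ⟶ Spec (.of k))
    (n : ℕ) : cubeOver f n ⟶ Spec (.of k) :=
  pullback.fst f (cubeStr k n) ≫ f

/-- The coordinate `yᵢ : □ⁿ_Y ⟶ □`. -/
noncomputable def cubeCoord {k : Type u} [Field k] {Y : Scheme.{u}} (f : Y ⟶ Spec (.of k))
    (n : ℕ) (i : Fin n) : cubeOver f n ⟶ (box k).toScheme :=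
  pullback.snd f (cubeStr k n) ≫ WidePullback.π (fun _ : Fin n => boxStr k) i

/-- (The underlying closed subset of) the face `Y × F` of `□ⁿ_Y`, where `F` is given by the
equations `yᵢ = εᵢ` for `i ∈ s`; it has codimension `s.card`. -/
def cubeFace {k : Type u} [Field k] {Y : Scheme.{u}} (f : Y ⟶ Spec (.of k))
    (n : ℕ) (s : Finset (Fin n)) (ε : Fin n → Fin 2) : Set (cubeOver f n) :=
  {x | ∀ i ∈ s, cubeCoord f n i x ∈ boxEnd k (ε i)}

/-- The projection `□ⁿ⁺¹_Y ⟶ □ⁿ_Y` that forgets the `i`-th coordinate. -/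
noncomputable def cubeForget {k : Type u} [Field k] {Y : Scheme.{u}} (f : Y ⟶ Spec (.of k))
    (n : ℕ) (i : Fin (n + 1)) : cubeOver f (n + 1) ⟶ cubeOver f n :=
  pullback.map f (cubeStr k (n + 1)) f (cubeStr k n) (𝟙 Y)
    (WidePullback.lift (cubeStr k (n + 1))
      (fun j => WidePullback.π (fun _ : Fin (n + 1) => boxStr k) (i.succAbove j))
      (fun j => WidePullback.π_arrow (fun _ : Fin (n + 1) => boxStr k) (i.succAbove j)))
    (𝟙 _) (by simp) (by rw [Category.comp_id, WidePullback.lift_base])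

/-- The base change `□ⁿ_{Y'} ⟶ □ⁿ_Y` of a morphism `j : Y' ⟶ Y` of `k`-schemes. -/
noncomputable def cubeMap {k : Type u} [Field k] {Y Y' : Scheme.{u}} (f : Y ⟶ Spec (.of k))
    (f' : Y' ⟶ Spec (.of k)) (j : Y' ⟶ Y) (h : j ≫ f = f') (n : ℕ) :
    cubeOver f' n ⟶ cubeOver f n :=
  pullback.map f' (cubeStr k n) f (cubeStr k n) j (𝟙 _) (𝟙 _) (by simp [h]) (by simp)

instance cubeMap_isOpenImmersion {k : Type u} [Field k] {Y Y' : Scheme.{u}} (f : Y ⟶ Spec (.of k))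
    (f' : Y' ⟶ Spec (.of k)) (j : Y' ⟶ Y) (h : j ≫ f = f') (n : ℕ) [IsOpenImmersion j] :
    IsOpenImmersion (cubeMap f f' j h n) := by
  unfold cubeMap; infer_instance

theorem cubeMap_fst {k : Type u} [Field k] {Y Y' : Scheme.{u}} (f : Y ⟶ Spec (.of k))
    (f' : Y' ⟶ Spec (.of k)) (j : Y' ⟶ Y) (h : j ≫ f = f') (n : ℕ) :
    cubeMap f f' j h n ≫ pullback.fst f (cubeStr k n) = pullback.fst f' (cubeStr k n) ≫ j :=
  pullback.lift_fst _ _ _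

theorem cubeMap_snd {k : Type u} [Field k] {Y Y' : Scheme.{u}} (f : Y ⟶ Spec (.of k))
    (f' : Y' ⟶ Spec (.of k)) (j : Y' ⟶ Y) (h : j ≫ f = f') (n : ℕ) :
    cubeMap f f' j h n ≫ pullback.snd f (cubeStr k n) = pullback.snd f' (cubeStr k n) :=
  (pullback.lift_snd _ _ _).trans (Category.comp_id _)

theorem cubeForget_fst {k : Type u} [Field k] {Y : Scheme.{u}} (f : Y ⟶ Spec (.of k))
    (n : ℕ) (i : Fin (n + 1)) :
    cubeForget f n i ≫ pullback.fst f (cubeStr k n) = pullback.fst f (cubeStr k (n + 1)) :=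
  (pullback.lift_fst _ _ _).trans (Category.comp_id _)

theorem cubeForget_snd {k : Type u} [Field k] {Y : Scheme.{u}} (f : Y ⟶ Spec (.of k))
    (n : ℕ) (i : Fin (n + 1)) :
    cubeForget f n i ≫ pullback.snd f (cubeStr k n) = pullback.snd f (cubeStr k (n + 1)) ≫
      WidePullback.lift (cubeStr k (n + 1))
        (fun j => WidePullback.π (fun _ : Fin (n + 1) => boxStr k) (i.succAbove j))
        (fun j => WidePullback.π_arrow (fun _ : Fin (n + 1) => boxStr k) (i.succAbove j)) :=
  pullback.lift_snd _ _ _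

theorem cubeForget_coord {k : Type u} [Field k] {Y : Scheme.{u}} (f : Y ⟶ Spec (.of k))
    (n : ℕ) (i : Fin (n + 1)) (j : Fin n) :
    cubeForget f n i ≫ cubeCoord f n j = cubeCoord f (n + 1) (i.succAbove j) := by
  rw [cubeCoord, cubeCoord, ← Category.assoc, cubeForget_snd, Category.assoc, WidePullback.lift_π]

theorem cubeMap_coord {k : Type u} [Field k] {Y Y' : Scheme.{u}} (f : Y ⟶ Spec (.of k))
    (f' : Y' ⟶ Spec (.of k)) (j : Y' ⟶ Y) (h : j ≫ f = f') (n : ℕ) (i : Fin n) :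
    cubeMap f f' j h n ≫ cubeCoord f n i = cubeCoord f' n i := by
  rw [cubeCoord, cubeCoord, ← Category.assoc, cubeMap_snd]

theorem cubeMap_forget {k : Type u} [Field k] {Y Y' : Scheme.{u}} (f : Y ⟶ Spec (.of k))
    (f' : Y' ⟶ Spec (.of k)) (j : Y' ⟶ Y) (h : j ≫ f = f') (n : ℕ) (i : Fin (n + 1)) :
    cubeMap f f' j h (n + 1) ≫ cubeForget f n i = cubeForget f' n i ≫ cubeMap f f' j h n := by
  apply pullback.hom_ext
  · rw [Category.assoc, Category.assoc, cubeForget_fst, cubeMap_fst, cubeMap_fst,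
      ← Category.assoc, cubeForget_fst]
  · rw [Category.assoc, Category.assoc, cubeForget_snd, cubeMap_snd, ← Category.assoc,
      cubeMap_snd, cubeForget_snd]

theorem cubeMap_comp {k : Type u} [Field k] {Y Y' Y'' : Scheme.{u}} (f : Y ⟶ Spec (.of k))
    (f' : Y' ⟶ Spec (.of k)) (f'' : Y'' ⟶ Spec (.of k)) (j : Y' ⟶ Y) (j' : Y'' ⟶ Y')
    (h : j ≫ f = f') (h' : j' ≫ f' = f'') (h'' : (j' ≫ j) ≫ f = f'') (n : ℕ) :
    cubeMap f f'' (j' ≫ j) h'' n = cubeMap f' f'' j' h' n ≫ cubeMap f f' j h n := by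
  apply pullback.hom_ext
  · rw [Category.assoc, cubeMap_fst, cubeMap_fst, ← Category.assoc, ← Category.assoc, cubeMap_fst]
  · rw [Category.assoc, cubeMap_snd, cubeMap_snd, cubeMap_snd]

theorem cubeMap_face {k : Type u} [Field k] {Y Y' : Scheme.{u}} (f : Y ⟶ Spec (.of k))
    (f' : Y' ⟶ Spec (.of k)) (j : Y' ⟶ Y) (h : j ≫ f = f') (n : ℕ) (s : Finset (Fin n))
    (ε : Fin n → Fin 2) :
    cubeMap f f' j h n ⁻¹' cubeFace f n s ε = cubeFace f' n s ε := by
  ext x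
  simp only [cubeFace, Set.mem_preimage, Set.mem_ofPred_eq]
  refine forall₂_congr fun i _ => ?_
  rw [← cubeMap_coord f f' j h n]; rfl

instance boxStr_locallyOfFiniteType (k : Type u) [Field k] : LocallyOfFiniteType (boxStr k) := by
  have h1 : Function.Surjective (algebraMap k (stdGrading k 0)) := by
    rintro ⟨p, hp⟩
    refine ⟨p.coeff 0, Subtype.ext ?_⟩
    have := (MvPolynomial.totalDegree_eq_zero_iff_eq_C (p := p)).1
      (Nat.le_zero.1 (((MvPolynomial.mem_homogeneousSubmodule 0 p).1 hp).totalDegree_le))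
    exact this.symm
  have h2 : Algebra.FiniteType (stdGrading k 0) (MvPolynomial (Fin 2) k) := by
    have : IsScalarTower k (stdGrading k 0) (MvPolynomial (Fin 2) k) :=
      IsScalarTower.of_algebraMap_eq (R := k) (S := stdGrading k 0) (A := MvPolynomial (Fin 2) k)
        (fun _ => rfl)
    exact Algebra.FiniteType.of_restrictScalars_finiteType k _ _
  have h3 : LocallyOfFiniteType
      (Spec.map (CommRingCat.ofHom (algebraMap k (stdGrading k 0)))) := by
    rw [HasRingHomProperty.Spec_iff (P := @LocallyOfFiniteType)]
    exact RingHom.FiniteType.of_surjective _ h1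
  unfold boxStr projLineStr
  infer_instance

instance cubeStr_locallyOfFiniteType (k : Type u) [Field k] (n : ℕ) :
    LocallyOfFiniteType (cubeStr k n) := by
  induction n with
  | zero =>
    have : IsIso (cubeStr k 0) := by
      refine ⟨WidePullback.lift (𝟙 _) (fun i => i.elim0) (fun i => i.elim0), ?_, ?_⟩
      · apply WidePullback.hom_ext
        · exact fun i => i.elim0
        · rw [Category.assoc, WidePullback.lift_base, Category.comp_id, Category.id_comp]
      · rw [WidePullback.lift_base]
    infer_instance
  | succ n ih =>
    have ha : WidePullback.π (fun _ : Fin (n + 1) => boxStr k) 0 ≫ boxStr k =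
        WidePullback.lift (cubeStr k (n + 1))
          (fun j => WidePullback.π (fun _ : Fin (n + 1) => boxStr k) j.succ)
          (fun j => WidePullback.π_arrow (fun _ : Fin (n + 1) => boxStr k) j.succ) ≫
            cubeStr k n := by
      rw [WidePullback.lift_base]
      exact WidePullback.π_arrow (fun _ : Fin (n + 1) => boxStr k) 0
    let a : cube k (n + 1) ⟶ pullback (boxStr k) (cubeStr k n) := pullback.lift _ _ ha
    have ha1 : a ≫ pullback.fst _ _ = WidePullback.π (fun _ : Fin (n + 1) => boxStr k) 0 :=
      pullback.lift_fst _ _ _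
    have ha2 : a ≫ pullback.snd _ _ = _ := pullback.lift_snd _ _ ha
    have hb : ∀ j : Fin (n + 1), Fin.cons (α := fun _ => pullback (boxStr k) (cubeStr k n) ⟶
        (box k).toScheme) (pullback.fst _ _)
        (fun j => pullback.snd _ _ ≫ WidePullback.π (fun _ : Fin n => boxStr k) j) j ≫ boxStr k =
        pullback.fst _ _ ≫ boxStr k := by
      intro j
      refine Fin.cases ?_ (fun j => ?_) j
      · rw [Fin.cons_zero]
      · rw [Fin.cons_succ, Category.assoc, WidePullback.π_arrow (fun _ : Fin n => boxStr k) j,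
          pullback.condition]
    let b : pullback (boxStr k) (cubeStr k n) ⟶ cube k (n + 1) := WidePullback.lift _ _ hb
    have hb1 (j) : b ≫ WidePullback.π (fun _ : Fin (n + 1) => boxStr k) j = _ :=
      WidePullback.lift_π _ _ _ hb j
    have hb2 : b ≫ cubeStr k (n + 1) = pullback.fst _ _ ≫ boxStr k :=
      WidePullback.lift_base _ _ _ hb
    have hab : a ≫ b = 𝟙 _ := by
      apply WidePullback.hom_ext
      · intro j
        rw [Category.assoc, hb1, Category.id_comp]
        refine Fin.cases ?_ (fun j => ?_) j
        · rw [Fin.cons_zero, ha1]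
        · rw [Fin.cons_succ, ← Category.assoc, ha2, WidePullback.lift_π]
      · rw [Category.assoc, hb2, ← Category.assoc, ha1, Category.id_comp]
        exact WidePullback.π_arrow (fun _ : Fin (n + 1) => boxStr k) 0
    have hba : b ≫ a = 𝟙 _ := by
      apply pullback.hom_ext
      · rw [Category.assoc, ha1, hb1, Fin.cons_zero, Category.id_comp]
      · rw [Category.assoc, ha2, Category.id_comp]
        apply WidePullback.hom_ext
        · intro j
          rw [Category.assoc, WidePullback.lift_π, hb1, Fin.cons_succ]
        · rw [Category.assoc, WidePullback.lift_base, hb2, pullback.condition]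
    have : IsIso a := ⟨b, hab, hba⟩
    have h : cubeStr k (n + 1) = a ≫ pullback.fst _ _ ≫ boxStr k := by
      rw [← Category.assoc, ha1]
      exact (WidePullback.π_arrow (fun _ : Fin (n + 1) => boxStr k) 0).symm
    rw [h]
    infer_instance

/-- An integral closed subscheme `Z` of `□ⁿ_Y` (given by its underlying irreducible closed subset)
is admissible if it has dimension `d + n` and intersects all faces properly: as `Y × F` is locally
cut out by `codim F` equations, this means that `dim (Z ∩ (Y × F)) ≤ dim Z - codim F`. Here
dimension is Krull dimension, and the empty set has dimension `-∞`. -/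
structure IsAdmissible {k : Type u} [Field k] {Y : Scheme.{u}} (f : Y ⟶ Spec (.of k))
    (d : ℤ) (n : ℕ) (Z : IrreducibleCloseds (cubeOver f n)) : Prop where
  dim_eq : ∃ r : ℕ, (r : ℤ) = d + n ∧ topologicalKrullDim (Z : Set (cubeOver f n)) = r
  proper : ∀ (s : Finset (Fin n)) (ε : Fin n → Fin 2),
    topologicalKrullDim ((Z : Set (cubeOver f n)) ∩ cubeFace f n s ε : Set (cubeOver f n)) +
      (s.card : WithBot ℕ∞) ≤ topologicalKrullDim (Z : Set (cubeOver f n))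

/-- The admissible integral closed subschemes of `□ⁿ_Y` of dimension `d + n`. -/
def Admissible {k : Type u} [Field k] {Y : Scheme.{u}} (f : Y ⟶ Spec (.of k))
    (d : ℤ) (n : ℕ) : Type u :=
  {Z : IrreducibleCloseds (cubeOver f n) // IsAdmissible f d n Z}

/-- The group `z̲_d(Y, n)` of admissible cycles. -/
abbrev AdmCycles {k : Type u} [Field k] {Y : Scheme.{u}} (f : Y ⟶ Spec (.of k))
    (d : ℤ) (n : ℕ) : Type u :=
  Admissible f d n →₀ ℤ

/-- `Z` is the pull-back of an admissible integral cycle `Z'` along a projection that forgets one of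
the coordinates. (As `□` is smooth and geometrically integral over `k`, the inverse image of `Z'` is
integral, so that the flat pull-back of the cycle `Z'` is this inverse image.) -/
def IsDegenerate {k : Type u} [Field k] {Y : Scheme.{u}} (f : Y ⟶ Spec (.of k)) (d : ℤ) :
    (n : ℕ) → Admissible f d n → Prop
  | 0, _ => False
  | n + 1, Z => ∃ (i : Fin (n + 1)) (Z' : Admissible f d n),
      (Z.1 : Set (cubeOver f (n + 1))) = cubeForget f n i ⁻¹' (Z'.1 : Set (cubeOver f n))

/-- The subgroup `z̲_d(Y, n)_degn` of degenerate cycles. -/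
noncomputable def degnCycles {k : Type u} [Field k] {Y : Scheme.{u}} (f : Y ⟶ Spec (.of k))
    (d : ℤ) (n : ℕ) : AddSubgroup (AdmCycles f d n) :=
  AddSubgroup.closure {x | ∃ Z, IsDegenerate f d n Z ∧ x = Finsupp.single Z 1}

/-- The group `z_d(Y, n) = z̲_d(Y, n) / z̲_d(Y, n)_degn` in degree `n` of the cubical higher Chow
complex. -/
abbrev HigherCycles {k : Type u} [Field k] {Y : Scheme.{u}} (f : Y ⟶ Spec (.of k))
    (d : ℤ) (n : ℕ) : Type u :=
  AdmCycles f d n ⧸ degnCycles f d n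

section Restriction

variable {k : Type u} [Field k] {Y Y' : Scheme.{u}} (f : Y ⟶ Spec (.of k))
    (f' : Y' ⟶ Spec (.of k)) (j : Y' ⟶ Y) [IsOpenImmersion j] (h : j ≫ f = f')
    [LocallyOfFiniteType f]

/-- The restriction of an admissible `Z`, meeting `□ⁿ_{Y'}`, to the open subscheme `□ⁿ_{Y'}`. -/
def Admissible.restrict {d : ℤ} {n : ℕ} (Z : Admissible f d n)
    (hZ : (cubeMap f f' j h n ⁻¹' (Z.1 : Set (cubeOver f n))).Nonempty) : Admissible f' d n :=
  ⟨{ carrier := cubeMap f f' j h n ⁻¹' (Z.1 : Set (cubeOver f n))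
     isIrreducible' := ⟨hZ, Z.1.isIrreducible.isPreirreducible.preimage
       (cubeMap f f' j h n).isOpenEmbedding⟩
     isClosed' := Z.1.isClosed.preimage (cubeMap f f' j h n).continuous },
   { dim_eq := by
       obtain ⟨r, hr, hr'⟩ := Z.2.dim_eq
       exact ⟨r, hr, (krullDim_preimage (cubeOverStr f n) (cubeMap f f' j h n) Z.1 hZ).trans hr'⟩
     proper := fun s ε => by
       refine le_trans ?_ ((Z.2.proper s ε).trans
         (krullDim_preimage (cubeOverStr f n) (cubeMap f f' j h n) Z.1 hZ).ge)
       gcongr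
       have := ((cubeMap f f' j h n).isOpenEmbedding.isInducing.restrictPreimage
         ((Z.1 : Set (cubeOver f n)) ∩ cubeFace f n s ε)).topologicalKrullDim_le
       rw [Set.preimage_inter, cubeMap_face] at this
       exact this }⟩

open Classical in
/-- The restriction of cycles `z̲_d(Y, n) → z̲_d(Y', n)` along an open immersion `j : Y' ⟶ Y`:
it sends `Z` to `Z ∩ □ⁿ_{Y'}` if this is non-empty, and to `0` otherwise. -/
noncomputable def admRestrict (d : ℤ) (n : ℕ) : AdmCycles f d n →+ AdmCycles f' d n :=
  Finsupp.liftAddHom fun Z =>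
    if hZ : (cubeMap f f' j h n ⁻¹' (Z.1 : Set (cubeOver f n))).Nonempty then
      Finsupp.singleAddHom (Z.restrict f f' j h hZ) else 0

theorem degnCycles_le_comap (d : ℤ) (n : ℕ) :
    degnCycles f d n ≤ (degnCycles f' d n).comap (admRestrict f f' j h d n) := by
  rw [degnCycles, AddSubgroup.closure_le]
  rintro _ ⟨Z, hZ, rfl⟩
  simp only [admRestrict, AddSubgroup.coe_comap, Set.mem_preimage, Finsupp.liftAddHom_apply_single]
  split_ifs with hne
  · refine AddSubgroup.subset_closure ⟨_, ?_, rfl⟩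
    match n, Z, hZ with
    | n + 1, Z, ⟨i, Z', hZ'⟩ =>
      have e : cubeMap f f' j h (n + 1) ⁻¹' (Z.1 : Set (cubeOver f (n + 1))) =
          cubeForget f' n i ⁻¹' (cubeMap f f' j h n ⁻¹' (Z'.1 : Set (cubeOver f n))) := by
        rw [hZ', ← Set.preimage_comp, ← Set.preimage_comp]
        exact congrArg (fun g : cubeOver f' (n + 1) ⟶ cubeOver f n =>
          g ⁻¹' (Z'.1 : Set (cubeOver f n))) (cubeMap_forget f f' j h n i)
      refine ⟨i, Z'.restrict f f' j h ?_, e⟩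
      obtain ⟨x, hx⟩ := hne
      exact ⟨_, e.le hx⟩
  · exact zero_mem _

/-- The flat restriction map `ρ : z_d(Y, n) → z_d(Y', n)` along an open immersion `j : Y' ⟶ Y`. -/
noncomputable def higherRestrict (d : ℤ) (n : ℕ) : HigherCycles f d n →+ HigherCycles f' d n :=
  QuotientAddGroup.map _ _ (admRestrict f f' j h d n) (degnCycles_le_comap f f' j h d n)

theorem higherRestrict_comp {Y'' : Scheme.{u}} (f'' : Y'' ⟶ Spec (.of k)) (j' : Y'' ⟶ Y')
    [IsOpenImmersion j'] (h' : j' ≫ f' = f'') [LocallyOfFiniteType f'] (j'' : Y'' ⟶ Y)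
    [IsOpenImmersion j''] (e : j'' = j' ≫ j) (h'' : j'' ≫ f = f'') (d : ℤ) (n : ℕ) :
    higherRestrict f f'' j'' h'' d n =
      (higherRestrict f' f'' j' h' d n).comp (higherRestrict f f' j h d n) := by
  subst e
  have key : admRestrict f f'' (j' ≫ j) h'' d n =
      (admRestrict f' f'' j' h' d n).comp (admRestrict f f' j h d n) := by
    refine Finsupp.addHom_ext' fun Z => ?_
    ext1
    have e : cubeMap f f'' (j' ≫ j) h'' n ⁻¹' (Z.1 : Set (cubeOver f n)) =
        cubeMap f' f'' j' h' n ⁻¹' (cubeMap f f' j h n ⁻¹' (Z.1 : Set (cubeOver f n))) := by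
      rw [cubeMap_comp f f' f'' j j' h h' h'' n]; rfl
    by_cases h1 : (cubeMap f f' j h n ⁻¹' (Z.1 : Set (cubeOver f n))).Nonempty
    · by_cases h2 : (cubeMap f f'' (j' ≫ j) h'' n ⁻¹' (Z.1 : Set (cubeOver f n))).Nonempty
      · have h3 : (cubeMap f' f'' j' h' n ⁻¹'
          ((Z.restrict f f' j h h1).1 : Set (cubeOver f' n))).Nonempty := by
          rw [e] at h2; exact h2
        simp only [admRestrict, AddMonoidHom.comp_apply, Finsupp.singleAddHom_apply,
          Finsupp.liftAddHom_apply_single, h1, h2, h3, dite_true]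
        congr 1
        exact Subtype.ext (IrreducibleCloseds.ext e)
      · have h3 : ¬ (cubeMap f' f'' j' h' n ⁻¹'
          ((Z.restrict f f' j h h1).1 : Set (cubeOver f' n))).Nonempty := by
          rw [e] at h2; exact h2
        simp only [admRestrict, AddMonoidHom.comp_apply, Finsupp.singleAddHom_apply,
          Finsupp.liftAddHom_apply_single, h1, h2, h3, dite_true, dite_false]
    · have h2 : ¬ (cubeMap f f'' (j' ≫ j) h'' n ⁻¹' (Z.1 : Set (cubeOver f n))).Nonempty := by
        rw [e]; rintro ⟨x, hx⟩; exact h1 ⟨_, hx⟩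
      simp only [admRestrict, AddMonoidHom.comp_apply, Finsupp.singleAddHom_apply,
          Finsupp.liftAddHom_apply_single, h1, h2, dite_false]
      simp
  refine QuotientAddGroup.addMonoidHom_ext _ (AddMonoidHom.ext fun x => ?_)
  change QuotientAddGroup.mk _ = QuotientAddGroup.mk _
  rw [key]; rfl

end Restriction

/-- `G_d(W, n) = ker (z_d(Y, n) → z_d(Y ∖ W, n))` for a closed subset `W` of `Y`: the cycles
supported over `W`. -/
noncomputable def supportedCycles {k : Type u} [Field k] {Y : Scheme.{u}} (f : Y ⟶ Spec (.of k))
    [LocallyOfFiniteType f] (d : ℤ) (n : ℕ) (W : Closeds Y) : AddSubgroup (HigherCycles f d n) :=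
  (higherRestrict f (Scheme.Opens.ι W.compl ≫ f) (Scheme.Opens.ι W.compl) rfl d n).ker

theorem supportedCycles_mono {k : Type u} [Field k] {Y : Scheme.{u}} (f : Y ⟶ Spec (.of k))
    [LocallyOfFiniteType f] (d : ℤ) (n : ℕ) {W₁ W₂ : Closeds Y} (hW : W₁ ≤ W₂) :
    supportedCycles f d n W₁ ≤ supportedCycles f d n W₂ := by
  intro x hx
  have hle : (W₂.compl : Y.Opens) ≤ W₁.compl := fun y hy hy' => hy (hW hy')
  rw [supportedCycles, AddMonoidHom.mem_ker] at hx ⊢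
  rw [higherRestrict_comp f (Scheme.Opens.ι W₁.compl ≫ f) (Scheme.Opens.ι W₁.compl) rfl
    (Scheme.Opens.ι W₂.compl ≫ f) (Y.homOfLE hle) (by simp) _ (by simp),
    AddMonoidHom.comp_apply, hx, map_zero]

/-- The presheaf `U ↦ A / G(U)` for a family of subgroups `G(U)` of an abelian group `A`, increasing
as `U` shrinks; its restriction maps are the natural quotient maps. -/
noncomputable def quotientPresheaf {X : TopCat.{u}} (A : Type u) [AddCommGroup A]
    (G : Opens X → AddSubgroup A) (hG : ∀ U V, V ≤ U → G U ≤ G V) :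
    TopCat.Presheaf AddCommGrpCat.{u} X where
  obj U := .of (A ⧸ G U.unop)
  map {U V} i := AddCommGrpCat.ofHom
    (QuotientAddGroup.map (G U.unop) (G V.unop) (AddMonoidHom.id A) (hG _ _ i.unop.le))
  map_id U := by
    refine AddCommGrpCat.hom_ext (AddMonoidHom.ext fun x => ?_)
    obtain ⟨x, rfl⟩ := QuotientAddGroup.mk_surjective x
    rfl
  map_comp {U V W} i i' := by
    refine AddCommGrpCat.hom_ext (AddMonoidHom.ext fun x => ?_)
    obtain ⟨x, rfl⟩ := QuotientAddGroup.mk_surjective x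
    rfl

/-- The presheaf `𝒮_{n,d} : U ↦ z_d(Y, n) / G_d(Y ∖ U, n)` on `Y`. -/
noncomputable def cyclePresheaf {k : Type u} [Field k] {Y : Scheme.{u}} (f : Y ⟶ Spec (.of k))
    [LocallyOfFiniteType f] (d : ℤ) (n : ℕ) : TopCat.Presheaf AddCommGrpCat.{u} Y.carrier :=
  quotientPresheaf (HigherCycles f d n) (fun U => supportedCycles f d n U.compl)
    (fun _ _ h => supportedCycles_mono f d n (fun _ hy hy' => hy (h hy')))

/-- `δ₀ : F(U ∪ V) → F(U) ⊕ F(V)`, `x ↦ (x|_U, x|_V)`. -/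
noncomputable def mayerVietorisZero {X : TopCat.{u}} (F : TopCat.Presheaf AddCommGrpCat.{u} X)
    (U V : Opens X) : F.obj (.op (U ⊔ V)) →+ F.obj (.op U) × F.obj (.op V) :=
  (F.map (homOfLE le_sup_left).op).hom.prod (F.map (homOfLE le_sup_right).op).hom

/-- `δ₁ : F(U) ⊕ F(V) → F(U ∩ V)`, `(x₁, x₂) ↦ x₁|_{U ∩ V} - x₂|_{U ∩ V}`. -/
noncomputable def mayerVietorisOne {X : TopCat.{u}} (F : TopCat.Presheaf AddCommGrpCat.{u} X)
    (U V : Opens X) : F.obj (.op U) × F.obj (.op V) →+ F.obj (.op (U ⊓ V)) :=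
  (F.map (homOfLE inf_le_left).op).hom.comp (AddMonoidHom.fst _ _) -
    (F.map (homOfLE inf_le_right).op).hom.comp (AddMonoidHom.snd _ _)

/-! ### Quotients of a group by conditions on coefficients attached to points -/

section QuotientPresheaf

variable {X : TopCat.{u}} {A B : Type u} [AddCommGroup A] (G : Opens X → AddSubgroup A)
  (hG : ∀ U V, V ≤ U → G U ≤ G V) (c : A →+ (B →₀ ℤ)) (y : B → X)
  (hc : Function.Surjective c) (hy : ∀ U x, x ∈ G U ↔ ∀ b, y b ∈ U → c x b = 0)

/-! Degenerate cycles are spanned by part of the basis of admissible subschemes, so `z_d(Y, n)` is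
free on the non-degenerate ones. Send each such `Z` to the image `y(Z)` in `Y` of its generic point.
The key claim (`mem_supportedCycles_compl_iff`) is that `G_d(Y ∖ U, n)` consists of the classes
whose coefficients vanish at all `Z` with `y(Z) ∈ U`. Hence `𝒮(U)` is free on the `Z` with `y(Z) ∈
U`, and restriction forgets basis elements. Surjectivity of restriction is built into the quotients,
and gluing and Mayer–Vietoris become statements about coefficient functions. Only finiteness of the
support of a glued function needs care; it follows from `Y` being Noetherian.

The key claim requires that restriction to an open `Y'` create no new degeneracy
(`IsDegenerate.of_restrict`). If `Z` restricts to the inverse image of `Z'` under a projection `p`,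
let `C` be the closure of `Z'`. As `p` is open, `p⁻¹(C) = Z`. To see that `C` meets faces properly,
the bound is transferred from `Z` by `dim p⁻¹(T) ≥ dim T + 1` (`krullDim_preimage_cubeForget`),
which holds because the zero section of `p` is a proper specialization inside every fibre. -/

theorem quotientPresheaf_isFlasque : (quotientPresheaf A G hG).IsFlasque where
  epi {U V} i := by
    refine (AddCommGrpCat.epi_iff_surjective _).2 fun x => ?_
    obtain ⟨x, rfl⟩ := QuotientAddGroup.mk_surjective (s := G V.unop) x
    exact ⟨(QuotientAddGroup.mk x : A ⧸ G U.unop), rfl⟩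

-- Thus `A ⧸ G U` embeds in the functions on the part of `B` lying over `U`; all later arguments
-- compare coefficients through this.
include hy in
theorem quotient_mk_eq_iff_of_mem_iff {U : Opens X} {x x' : A} :
    (QuotientAddGroup.mk x : A ⧸ G U) = QuotientAddGroup.mk x' ↔
      ∀ b, y b ∈ U → c x b = c x' b := by
  rw [QuotientAddGroup.eq, hy]
  refine forall₂_congr fun b _ => ?_
  rw [map_add, map_neg, Finsupp.add_apply, Finsupp.neg_apply, neg_add_eq_zero]

include hc hy in
theorem quotientPresheaf_isSheaf [NoetherianSpace X] : (quotientPresheaf A G hG).IsSheaf := by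
  classical
  rw [TopCat.Presheaf.isSheaf_iff_isSheafUniqueGluing]
  intro ι U sf hsf
  have mk_eq {V : Opens X} {x x' : A} := quotient_mk_eq_iff_of_mem_iff G c y hy (U := V)
    (x := x) (x' := x')
  choose a ha using fun i => QuotientAddGroup.mk_surjective (s := G (U i)) (sf i)
  have compat : ∀ i j b, y b ∈ U i → y b ∈ U j → c (a i) b = c (a j) b := by
    intro i j b hi hj
    have h := hsf i j
    rw [← ha i, ← ha j] at h
    exact mk_eq.1 h b ⟨hi, hj⟩
  -- Finitely many `U i` suffice, so the glued function is supported in a finite union of finite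
  -- supports.
  obtain ⟨t, ht⟩ := (NoetherianSpace.isCompact ((iSup U : Opens X) : Set X)).elim_finite_subcover
    (fun i => (U i : Set X)) (fun i => (U i).2) (by rw [Opens.coe_iSup])
  have ht' (b) (hb : y b ∈ iSup U) : ∃ i ∈ t, y b ∈ U i := by
    obtain ⟨i, hi, hb⟩ := Set.mem_iUnion₂.1 (ht hb)
    exact ⟨i, hi, hb⟩
  -- By `compat` the chosen index does not matter; the value `0` off the union keeps the support
  -- finite.
  let g : B → ℤ := fun b => if hb : y b ∈ iSup U then c (a (ht' b hb).choose) b else 0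
  have hg (i b) (hb : y b ∈ U i) : g b = c (a i) b := by
    have hb' : y b ∈ iSup U := (le_iSup U i) hb
    simp only [g, hb', dite_true]
    exact compat _ _ _ (ht' b hb').choose_spec.2 hb
  have hfin : g.support.Finite := by
    refine (t.biUnion fun i => (c (a i)).support).finite_toSet.subset fun b hb => ?_
    by_cases hb' : y b ∈ iSup U
    · obtain ⟨i, hi, hbi⟩ := ht' b hb'
      rw [Function.mem_support, hg i b hbi] at hb
      exact Finset.mem_biUnion.2 ⟨i, hi, Finsupp.mem_support_iff.2 hb⟩
    · exact absurd (by simp only [g, hb', dite_false]) hb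
  obtain ⟨x, hx⟩ := hc (Finsupp.ofSupportFinite g hfin)
  have hx' (b) : c x b = g b := by rw [hx]; rfl
  refine ⟨(QuotientAddGroup.mk x : A ⧸ G (iSup U)), fun i => ?_, fun s hs => ?_⟩
  · rw [← ha i]
    exact mk_eq.2 fun b hb => (hx' b).trans (hg i b hb)
  · obtain ⟨s, rfl⟩ := QuotientAddGroup.mk_surjective (s := G (iSup U)) s
    refine mk_eq.2 fun b hb => ?_
    obtain ⟨i, -, hi⟩ := ht' b hb
    have h := hs i
    rw [← ha i] at h
    rw [hx', hg i b hi]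
    exact mk_eq.1 h b hi

include hc hy in
theorem quotientPresheaf_mayerVietoris (U V : Opens X) :
    Function.Injective (mayerVietorisZero (quotientPresheaf A G hG) U V) ∧
      Function.Exact (mayerVietorisZero (quotientPresheaf A G hG) U V)
        (mayerVietorisOne (quotientPresheaf A G hG) U V) ∧
      Function.Surjective (mayerVietorisOne (quotientPresheaf A G hG) U V) := by
  classical
  have mk_eq {V : Opens X} {x x' : A} := quotient_mk_eq_iff_of_mem_iff G c y hy (U := V)
    (x := x) (x' := x')
  have zero_mk (x : A) : mayerVietorisZero (quotientPresheaf A G hG) U V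
      (QuotientAddGroup.mk x : A ⧸ G (U ⊔ V)) =
      ((QuotientAddGroup.mk x : A ⧸ G U), (QuotientAddGroup.mk x : A ⧸ G V)) := rfl
  have one_mk (x x' : A) : mayerVietorisOne (quotientPresheaf A G hG) U V
      ((QuotientAddGroup.mk x : A ⧸ G U), (QuotientAddGroup.mk x' : A ⧸ G V)) =
      (QuotientAddGroup.mk (x - x') : A ⧸ G (U ⊓ V)) := rfl
  refine ⟨fun s s' h => ?_, fun s => ?_, fun s => ?_⟩
  · obtain ⟨s, rfl⟩ := QuotientAddGroup.mk_surjective (s := G (U ⊔ V)) s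
    obtain ⟨s', rfl⟩ := QuotientAddGroup.mk_surjective (s := G (U ⊔ V)) s'
    rw [zero_mk, zero_mk] at h
    refine mk_eq.2 fun b hb => ?_
    rcases hb with hb | hb
    · exact mk_eq.1 (congrArg Prod.fst h) b hb
    · exact mk_eq.1 (congrArg Prod.snd h) b hb
  · obtain ⟨s₁, s₂⟩ := s
    obtain ⟨x₁, rfl⟩ := QuotientAddGroup.mk_surjective (s := G U) s₁
    obtain ⟨x₂, rfl⟩ := QuotientAddGroup.mk_surjective (s := G V) s₂
    constructor
    · intro h
      rw [one_mk] at h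
      have h' : ∀ b, y b ∈ U ⊓ V → c x₁ b = c x₂ b := fun b hb => by
        have := mk_eq.1 (h.trans (QuotientAddGroup.mk_zero (G (U ⊓ V))).symm) b hb
        rwa [map_sub, map_zero, Finsupp.sub_apply, Finsupp.zero_apply, sub_eq_zero] at this
      -- Take the coefficients of `x₁` over `U` and those of `x₂` elsewhere; over `U ⊓ V` the two
      -- agree by `h'`.
      obtain ⟨x, hx⟩ := hc ((c x₁).filter (fun b => y b ∈ U) + (c x₂).filter (fun b => y b ∉ U))
      refine ⟨(QuotientAddGroup.mk x : A ⧸ G (U ⊔ V)), ?_⟩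
      rw [zero_mk]
      refine Prod.ext (mk_eq.2 fun b hb => ?_) (mk_eq.2 fun b hb => ?_)
      · simp [hx, hb]
      · by_cases hb' : y b ∈ U
        · simp [hx, hb', h' b ⟨hb', hb⟩]
        · simp [hx, hb']
    · rintro ⟨s, hs⟩
      obtain ⟨x, rfl⟩ := QuotientAddGroup.mk_surjective (s := G (U ⊔ V)) s
      rw [zero_mk] at hs
      rw [one_mk]
      refine (mk_eq.2 fun b hb => ?_).trans (QuotientAddGroup.mk_zero (G (U ⊓ V)))
      rw [map_sub, map_zero, Finsupp.sub_apply, Finsupp.zero_apply, sub_eq_zero,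
        ← mk_eq.1 (congrArg Prod.fst hs) b hb.1, ← mk_eq.1 (congrArg Prod.snd hs) b hb.2]
  · obtain ⟨x, rfl⟩ := QuotientAddGroup.mk_surjective (s := G (U ⊓ V)) s
    refine ⟨((QuotientAddGroup.mk x : A ⧸ G U), (QuotientAddGroup.mk 0 : A ⧸ G V)), ?_⟩
    rw [one_mk, sub_zero]

end QuotientPresheaf

/-! ### Points of `□` through the affine coordinate `t = X₀ / (X₀ - X₁)` -/

section BoxPoints

variable (k : Type u) [Field k] (R S : Type u) [CommRing R] [Algebra k R] [CommRing S] [Algebra k S]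

theorem X_sub_X_mem_stdGrading :
    (MvPolynomial.X 0 - MvPolynomial.X 1 : MvPolynomial (Fin 2) k) ∈ stdGrading k 1 :=
  sub_mem (MvPolynomial.isHomogeneous_X k 0) (MvPolynomial.isHomogeneous_X k 1)

/-- The homomorphism from the localization of `k[X₀, X₁]` at `X₀ - X₁` that sends `X₀` to `t` and
`X₁` to `t - 1`. -/
noncomputable def localizationToPoint (t : R) :
    Localization.Away (MvPolynomial.X 0 - MvPolynomial.X 1 : MvPolynomial (Fin 2) k) →+* R :=
  IsLocalization.Away.lift (MvPolynomial.X 0 - MvPolynomial.X 1 : MvPolynomial (Fin 2) k)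
    -- The pair `(t, t - 1)` is normalized so that `X₀ - X₁` maps to `1`, a unit. The value `t = 0`
    -- corresponds to `y = 0`.
    (g := (MvPolynomial.aeval (R := k) ![t, t - 1]).toRingHom) (by simp)

/-- The homomorphism from the coordinate ring of `□` to `R` that sends `X₀ / (X₀ - X₁)` to `t`. -/
noncomputable def awayToPoint (t : R) :
    HomogeneousLocalization.Away (stdGrading k) (MvPolynomial.X 0 - MvPolynomial.X 1) →+* R :=
  (localizationToPoint k R t).comp (algebraMap _ _)

theorem localizationToPoint_algebraMap (t : R) (p : MvPolynomial (Fin 2) k) :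
    localizationToPoint k R t (algebraMap _ _ p) = MvPolynomial.aeval ![t, t - 1] p :=
  IsLocalization.Away.lift_eq _ _ _

variable {R S} in
theorem comp_awayToPoint (t : R) (ψ : R →ₐ[k] S) :
    (ψ : R →+* S).comp (awayToPoint k R t) = awayToPoint k S (ψ t) := by
  rw [awayToPoint, awayToPoint, ← RingHom.comp_assoc]
  congr 1
  refine IsLocalization.ringHom_ext
    (Submonoid.powers (MvPolynomial.X 0 - MvPolynomial.X 1 : MvPolynomial (Fin 2) k))
    (RingHom.ext fun p => ?_)
  simp only [RingHom.comp_apply, localizationToPoint_algebraMap]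
  have h : ψ.comp (MvPolynomial.aeval ![t, t - 1]) = MvPolynomial.aeval (R := k)
      ![ψ t, ψ t - 1] := by
    refine MvPolynomial.algHom_ext fun i => ?_
    fin_cases i <;> simp
  exact DFunLike.congr_fun h p

/-- The element is the coordinate `X₀ / (X₀ - X₁)` itself; it serves to tell points of `□` apart. -/
theorem exists_awayToPoint_eq :
    ∃ a : HomogeneousLocalization.Away (stdGrading k) (MvPolynomial.X 0 - MvPolynomial.X 1),
      ∀ (R : Type u) [CommRing R] [Algebra k R] (t : R), awayToPoint k R t a = t := by
  refine ⟨HomogeneousLocalization.Away.mk _ (X_sub_X_mem_stdGrading k) 1 (MvPolynomial.X 0)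
    (MvPolynomial.isHomogeneous_X k 0), fun R _ _ t => ?_⟩
  have h : (algebraMap _ _ (MvPolynomial.X 0 : MvPolynomial (Fin 2) k)) =
      Localization.mk (MvPolynomial.X 0 : MvPolynomial (Fin 2) k)
        (⟨(MvPolynomial.X 0 - MvPolynomial.X 1) ^ 1, 1, rfl⟩ : Submonoid.powers _) *
      algebraMap _ (Localization.Away (MvPolynomial.X 0 - MvPolynomial.X 1))
        (MvPolynomial.X 0 - MvPolynomial.X 1 : MvPolynomial (Fin 2) k) := by
    rw [← Localization.mk_one_eq_algebraMap, ← Localization.mk_one_eq_algebraMap,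
      Localization.mk_mul, Localization.mk_eq_mk_iff, Localization.r_iff_exists]
    exact ⟨1, by simp [mul_comm]⟩
  have h2 := congrArg (localizationToPoint k R t) h
  rw [map_mul, localizationToPoint_algebraMap, localizationToPoint_algebraMap] at h2
  simp only [map_sub, MvPolynomial.aeval_X, Matrix.cons_val_zero, Matrix.cons_val_one,
    sub_sub_cancel, mul_one] at h2
  exact h2.symm

/-- The identification of the spectrum of the degree zero part of `k[X₀, X₁]` localized at `X₀ - X₁`
with `□`. -/
noncomputable def boxChart :
    Spec (.of (HomogeneousLocalization.Away (stdGrading k)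
      (MvPolynomial.X 0 - MvPolynomial.X 1))) ⟶ (box k).toScheme :=
  (Proj.basicOpenIsoSpec (stdGrading k) _ (X_sub_X_mem_stdGrading k) one_pos).inv

theorem boxChart_injective : Function.Injective (boxChart k) :=
  (Proj.basicOpenIsoSpec (stdGrading k) _
    (X_sub_X_mem_stdGrading k) one_pos).inv.homeomorph.injective

theorem boxChart_toSpecZero : boxChart k ≫ (box k).ι ≫ Proj.toSpecZero (stdGrading k) =
    Spec.map (CommRingCat.ofHom (HomogeneousLocalization.fromZeroRingHom (stdGrading k) _)) := by
  have h := Proj.awayι_toSpecZero (stdGrading k) _ (X_sub_X_mem_stdGrading k) one_pos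
  rwa [Proj.awayι, Category.assoc] at h

/-- The `R`-valued point of `□` with `X₀ / (X₀ - X₁) = t`. -/
noncomputable def boxPoint (t : R) : Spec (.of R) ⟶ (box k).toScheme :=
  Spec.map (CommRingCat.ofHom (awayToPoint k R t)) ≫ boxChart k

variable {R S} in
theorem specMap_boxPoint (t : R) (ψ : R →ₐ[k] S) :
    Spec.map (CommRingCat.ofHom (ψ : R →+* S)) ≫ boxPoint k R t = boxPoint k S (ψ t) := by
  rw [boxPoint, boxPoint, ← Category.assoc, ← Spec.map_comp, ← CommRingCat.ofHom_comp,
    comp_awayToPoint]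

theorem boxPoint_boxStr (t : R) :
    boxPoint k R t ≫ boxStr k = Spec.map (CommRingCat.ofHom (algebraMap k R)) := by
  have h := boxChart_toSpecZero k
  rw [boxPoint, boxStr, projLineStr, Category.assoc, reassoc_of% h, ← Spec.map_comp, ← Spec.map_comp, ← CommRingCat.ofHom_comp, ← CommRingCat.ofHom_comp]
  congr 2
  refine RingHom.ext fun a => ?_
  have h2 := localizationToPoint_algebraMap k R t (MvPolynomial.C a)
  rw [MvPolynomial.aeval_C] at h2
  exact h2

/-- The coordinate of `□` pulls back to `X`, which lies in only one of the two primes. This will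
separate the generic point of a fibre from its origin. -/
theorem boxPoint_X_ne (K : Type u) [Field K] [Algebra k K] (p q : Spec (.of (Polynomial K)))
    (hp : Polynomial.X ∉ p.asIdeal) (hq : Polynomial.X ∈ q.asIdeal) :
    boxPoint k (Polynomial K) Polynomial.X p ≠ boxPoint k (Polynomial K) Polynomial.X q := by
  intro h
  obtain ⟨a, ha⟩ := exists_awayToPoint_eq k
  have h2 : Spec.map (CommRingCat.ofHom (awayToPoint k (Polynomial K) Polynomial.X)) p =
      Spec.map (CommRingCat.ofHom (awayToPoint k (Polynomial K) Polynomial.X)) q :=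
    boxChart_injective k h
  have h3 : a ∈ (Spec.map (CommRingCat.ofHom (awayToPoint k (Polynomial K) Polynomial.X)) q).asIdeal := by
    change awayToPoint k (Polynomial K) Polynomial.X a ∈ q.asIdeal
    rwa [ha]
  rw [← h2] at h3
  change awayToPoint k (Polynomial K) Polynomial.X a ∈ p.asIdeal at h3
  rw [ha] at h3
  exact hp h3

theorem isClosed_boxEnd (e : Fin 2) : IsClosed (boxEnd k e) := by
  have h : boxEnd k e = ((box k).ι ⁻¹ᵁ Proj.basicOpen (stdGrading k) (MvPolynomial.X e) :
      Set (box k).toScheme)ᶜ := by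
    ext p
    exact not_not.symm
  rw [h, isClosed_compl_iff]
  exact Opens.isOpen _

end BoxPoints

/-! ### Projections forgetting a coordinate: openness and dimension of inverse images -/

section CubeForget

variable {k : Type u} [Field k] {Y : Scheme.{u}} (f : Y ⟶ Spec (.of k)) (n : ℕ)

theorem isClosed_cubeFace (s : Finset (Fin n)) (ε : Fin n → Fin 2) :
    IsClosed (cubeFace f n s ε) := by
  have h : cubeFace f n s ε = ⋂ i ∈ s, cubeCoord f n i ⁻¹' boxEnd k (ε i) := by
    ext x; simp [cubeFace]
  rw [h]
  exact isClosed_biInter fun i _ => (isClosed_boxEnd k _).preimage (cubeCoord f n i).continuous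

theorem cubeCoord_boxStr (i : Fin n) : cubeCoord f n i ≫ boxStr k = cubeOverStr f n := by
  rw [cubeCoord, Category.assoc, WidePullback.π_arrow (fun _ : Fin n => boxStr k) i,
    ← pullback.condition]

theorem cubeOver_hom_ext {W : Scheme.{u}} {a b : W ⟶ cubeOver f n}
    (h : a ≫ pullback.fst f (cubeStr k n) = b ≫ pullback.fst f (cubeStr k n))
    (h' : ∀ i, a ≫ cubeCoord f n i = b ≫ cubeCoord f n i) : a = b := by
  refine pullback.hom_ext h (WidePullback.hom_ext _ _ _ (fun i => ?_) ?_)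
  · simpa only [cubeCoord, Category.assoc] using h' i
  · rw [Category.assoc, Category.assoc, ← pullback.condition, ← Category.assoc, h, Category.assoc]

/-- A morphism to `□ⁿ⁺¹_Y` is one to `□ⁿ_Y` together with a coordinate to insert in position `i`.
The square gives openness of the projection by base change and a means to construct sections and
fibres. -/
theorem isPullback_cubeForget (i : Fin (n + 1)) :
    IsPullback (cubeForget f n i) (cubeCoord f (n + 1) i) (cubeOverStr f n) (boxStr k) := by
  refine ⟨⟨?_⟩, ⟨PullbackCone.IsLimit.mk _ (fun s => pullback.lift
    (s.fst ≫ pullback.fst _ _) (WidePullback.lift (s.fst ≫ cubeOverStr f n)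
      (i.insertNth (α := fun _ => s.pt ⟶ (box k).toScheme) s.snd
        (fun j => s.fst ≫ cubeCoord f n j)) ?_) ?_) ?_ ?_ ?_⟩⟩
  · rw [cubeCoord_boxStr, cubeOverStr, ← Category.assoc, cubeForget_fst]
  · intro j
    refine Fin.succAboveCases i ?_ (fun j => ?_) j
    · rw [Fin.insertNth_apply_same, s.condition]
    · rw [Fin.insertNth_apply_succAbove, Category.assoc, cubeCoord_boxStr]
  · rw [WidePullback.lift_base, Category.assoc]
  · intro s
    refine cubeOver_hom_ext f n ?_ fun j => ?_
    · rw [Category.assoc, cubeForget_fst, pullback.lift_fst]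
    · rw [Category.assoc, cubeForget_coord, cubeCoord, ← Category.assoc, pullback.lift_snd,
        WidePullback.lift_π, Fin.insertNth_apply_succAbove]
  · intro s
    rw [cubeCoord, ← Category.assoc, pullback.lift_snd, WidePullback.lift_π,
      Fin.insertNth_apply_same]
  · intro s m h1 h2
    refine cubeOver_hom_ext f (n + 1) ?_ fun j => ?_
    · rw [pullback.lift_fst, ← h1, Category.assoc, cubeForget_fst]
    · conv_rhs => rw [cubeCoord, ← Category.assoc, pullback.lift_snd, WidePullback.lift_π]
      refine Fin.succAboveCases i ?_ (fun j => ?_) j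
      · rw [Fin.insertNth_apply_same, ← h2]
      · rw [Fin.insertNth_apply_succAbove, ← h1, Category.assoc, cubeForget_coord]

/-- The projection is a base change of `□ ⟶ Spec k`, which is universally open because the base is a
field. -/
theorem isOpenMap_cubeForget (i : Fin (n + 1)) : IsOpenMap (cubeForget f n i) := by
  have : UniversallyOpen (boxStr k) := inferInstance
  have : UniversallyOpen (cubeForget f n i) :=
    MorphismProperty.of_isPullback (isPullback_cubeForget f n i).flip this
  exact (cubeForget f n i).isOpenMap

/-- The section `y_i = 0` of the projection `□ⁿ⁺¹_Y ⟶ □ⁿ_Y`. -/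
noncomputable def cubeZeroSection (i : Fin (n + 1)) : cubeOver f n ⟶ cubeOver f (n + 1) :=
  (isPullback_cubeForget f n i).lift (𝟙 _) (cubeOverStr f n ≫ boxPoint k k 0) (by
    rw [Category.assoc, boxPoint_boxStr]
    exact congrArg (cubeOverStr f n ≫ ·) (Spec.map_id (.of k)).symm)

theorem cubeZeroSection_forget (i : Fin (n + 1)) :
    cubeZeroSection f n i ≫ cubeForget f n i = 𝟙 _ :=
  (isPullback_cubeForget f n i).lift_fst _ _ _

/-- The zero section specializes strictly inside each fibre of the projection. -/
theorem exists_specializes_cubeZeroSection (i : Fin (n + 1)) (x : cubeOver f n) :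
    ∃ ξ : cubeOver f (n + 1), cubeForget f n i ξ = x ∧ ξ ⤳ cubeZeroSection f n i x ∧
      ξ ≠ cubeZeroSection f n i x := by
  let X := cubeOver f n
  let K := X.residueField x
  let φ : CommRingCat.of k ⟶ K := Spec.preimage (X.fromSpecResidueField x ≫ cubeOverStr f n)
  have hφ : Spec.map φ = X.fromSpecResidueField x ≫ cubeOverStr f n := Spec.map_preimage _
  algebraize [φ.hom]
  let C : Spec (.of (Polynomial K)) ⟶ Spec K := Spec.map (CommRingCat.ofHom Polynomial.C)
  have hC : (C ≫ X.fromSpecResidueField x) ≫ cubeOverStr f n =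
      boxPoint k (Polynomial K) Polynomial.X ≫ boxStr k := by
    rw [boxPoint_boxStr, Category.assoc, ← hφ]
    exact (Spec.map_comp φ (CommRingCat.ofHom Polynomial.C)).symm
  -- The affine line over the residue field of `x`, mapped to the fibre over `x` with `X` as its
  -- `i`-th coordinate. Its generic point will give `ξ`, its origin the point on the zero section.
  let g : Spec (.of (Polynomial K)) ⟶ cubeOver f (n + 1) :=
    (isPullback_cubeForget f n i).lift _ _ hC
  have hg1 : g ≫ cubeForget f n i = C ≫ X.fromSpecResidueField x :=
    (isPullback_cubeForget f n i).lift_fst _ _ _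
  have hg2 : g ≫ cubeCoord f (n + 1) i = boxPoint k (Polynomial K) Polynomial.X :=
    (isPullback_cubeForget f n i).lift_snd _ _ _
  let ev : Polynomial K →ₐ[k] K := (Polynomial.aeval (R := K) (0 : K)).restrictScalars k
  let z : Spec K ⟶ Spec (.of (Polynomial K)) := Spec.map (CommRingCat.ofHom (ev : Polynomial K →+* K))
  have hzC : z ≫ C = 𝟙 _ := by
    refine (Spec.map_comp (CommRingCat.ofHom Polynomial.C)
      (CommRingCat.ofHom (ev : Polynomial K →+* K))).symm.trans ?_
    rw [← Spec.map_id]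
    congr 1
    ext a
    exact Polynomial.aeval_C (R := K) (0 : K) a
  -- Both sides lie over `x` and have `i`-th coordinate `0`.
  have hz : z ≫ g = X.fromSpecResidueField x ≫ cubeZeroSection f n i := by
    apply (isPullback_cubeForget f n i).hom_ext
    · rw [Category.assoc, hg1, ← Category.assoc, hzC, Category.id_comp, Category.assoc,
        cubeZeroSection_forget, Category.comp_id]
    · rw [Category.assoc, hg2, Category.assoc, cubeZeroSection, IsPullback.lift_snd,
        ← Category.assoc, ← hφ]
      have h1 := specMap_boxPoint k (Polynomial.X : Polynomial K) ev
      have h2 := specMap_boxPoint k (0 : k) (Algebra.ofId k K)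
      rw [map_zero] at h2
      have h3 : ev Polynomial.X = 0 := by simp [ev]
      rw [h3] at h1
      exact h1.trans h2.symm
  let pt : Spec K := IsLocalRing.closedPoint K
  have hpt : X.fromSpecResidueField x pt = x := X.fromSpecResidueField_apply x pt
  have hs : cubeZeroSection f n i x = g (z pt) := by
    rw [← Scheme.Hom.comp_apply, hz, Scheme.Hom.comp_apply, hpt]
  let η : Spec (.of (Polynomial K)) := (⊥ : PrimeSpectrum (Polynomial K))
  refine ⟨g η, ?_, ?_, ?_⟩
  · rw [← Scheme.Hom.comp_apply, hg1, Scheme.Hom.comp_apply]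
    have : C η = pt := Subsingleton.elim _ _
    rw [this, hpt]
  · rw [hs]
    refine Specializes.map ?_ g.continuous
    exact (PrimeSpectrum.le_iff_specializes _ _).1 bot_le
  · rw [hs]
    intro h
    refine boxPoint_X_ne k K η (z pt) ?_ ?_ ?_
    · exact fun h => Polynomial.X_ne_zero h
    · change ev Polynomial.X ∈ pt.asIdeal
      rw [show ev Polynomial.X = 0 by simp [ev]]
      exact zero_mem _
    · rw [← hg2, Scheme.Hom.comp_apply, h, Scheme.Hom.comp_apply]

/-- The zero section embeds a chain of irreducible closed subsets of `T` in the inverse image. The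
chain then extends by one term: over the generic point `η` of its largest member lies a point `ξ`
specializing strictly to the zero section at `η`. -/
theorem krullDim_preimage_cubeForget (i : Fin (n + 1)) {T : Set (cubeOver f n)} (hT : IsClosed T) :
    topologicalKrullDim T + 1 ≤ topologicalKrullDim (cubeForget f n i ⁻¹' T) := by
  -- For empty `T` the dimension is `⊥`, and `⊥ + 1 = ⊥`.
  rcases isEmpty_or_nonempty (IrreducibleCloseds T) with he | he
  · rw [topologicalKrullDim, Order.krullDim_eq_bot, WithBot.bot_add]
    exact bot_le
  rw [topologicalKrullDim, Order.krullDim_eq_iSup_length, ← WithBot.coe_one, ← WithBot.coe_add,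
    ENat.iSup_add, WithBot.coe_iSup (OrderTop.bddAbove _)]
  refine iSup_le fun l => ?_
  have hsec (x) : cubeForget f n i (cubeZeroSection f n i x) = x := by
    rw [← Scheme.Hom.comp_apply, cubeZeroSection_forget]; rfl
  have : QuasiSober T := hT.isClosedEmbedding_subtypeVal.quasiSober
  let g : T → (cubeForget f n i ⁻¹' T : Set _) := fun x =>
    ⟨cubeZeroSection f n i x, by rw [Set.mem_preimage, hsec]; exact x.2⟩
  have hgc : Continuous g :=
    ((cubeZeroSection f n i).continuous.comp continuous_subtype_val).subtype_mk _
  -- The section has the projection as a continuous left inverse; being inducing makes closures of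
  -- images strictly increasing along the chain.
  have hgi : Topology.IsInducing g := by
    refine .of_comp hgc ((cubeForget f n i).continuous.comp continuous_subtype_val) ?_
    rw [show (cubeForget f n i ∘ Subtype.val) ∘ g = Subtype.val from funext fun x => hsec x]
    exact .subtypeVal
  let η := l.last.isIrreducible.genericPoint
  obtain ⟨ξ, h1, h2, h3⟩ := exists_specializes_cubeZeroSection f n i η
  let ξ' : (cubeForget f n i ⁻¹' T : Set _) := ⟨ξ, by rw [Set.mem_preimage, h1]; exact η.2⟩
  have h2' : ξ' ⤳ g η := (Topology.IsInducing.subtypeVal.specializes_iff).1 h2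
  have hη : closure {η} = (l.last : Set T) := by
    rw [l.last.isIrreducible.closure_genericPoint l.last.isClosed]
  let Z : IrreducibleCloseds (cubeForget f n i ⁻¹' T : Set _) :=
    ⟨closure {ξ'}, isIrreducible_singleton.closure, isClosed_closure⟩
  let l' := l.map (IrreducibleCloseds.map g hgc)
    (IrreducibleCloseds.map_strictMono_of_isInducing hgi)
  have hlast : l'.last < Z := by
    have hl : (l'.last : Set (cubeForget f n i ⁻¹' T : Set _)) = closure {g η} := by
      change closure (g '' (l.last : Set T)) = _
      rw [← hη, closure_image_closure hgc, Set.image_singleton]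
    refine lt_of_le_of_ne ?_ fun h => ?_
    · change (l'.last : Set _) ⊆ closure {ξ'}
      rw [hl]
      exact h2'.closure_subset
    · have : closure {g η} = closure {ξ'} := hl.symm.trans (congrArg _ h)
      exact h3 (congrArg Subtype.val ((inseparable_iff_closure_eq.2 this).eq)).symm
  exact le_iSup (fun l : LTSeries (IrreducibleCloseds (cubeForget f n i ⁻¹' T : Set _)) =>
    ((l.length : ℕ∞) : WithBot ℕ∞)) (l'.snoc Z hlast)

end CubeForget

/-! ### Restriction to open subschemes and degeneracy -/

section AdmissibleRestriction

variable {k : Type u} [Field k] {Y Y' : Scheme.{u}} (f : Y ⟶ Spec (.of k))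
    (f' : Y' ⟶ Spec (.of k)) (j : Y' ⟶ Y) (h : j ≫ f = f')

theorem range_cubeMap (n : ℕ) :
    Set.range (cubeMap f f' j h n) = pullback.fst f (cubeStr k n) ⁻¹' Set.range j := by
  rw [cubeMap, Scheme.Pullback.range_map]
  have : Set.range (𝟙 (cube k n) : cube k n ⟶ cube k n) = Set.univ :=
    Set.range_eq_univ.2 fun x => ⟨x, rfl⟩
  rw [this, Set.preimage_univ, Set.inter_univ]

/-- The projection preserves the image in `Y`, so a point whose projection lies over `Y'` already
lies in `□ⁿ⁺¹_{Y'}`. -/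
theorem cubeForget_preimage_image_cubeMap (n : ℕ) (i : Fin (n + 1)) (S : Set (cubeOver f' n))
    [IsOpenImmersion j] :
    cubeForget f n i ⁻¹' (cubeMap f f' j h n '' S) =
      cubeMap f f' j h (n + 1) '' (cubeForget f' n i ⁻¹' S) := by
  have comm (x) : cubeForget f n i (cubeMap f f' j h (n + 1) x) =
      cubeMap f f' j h n (cubeForget f' n i x) := by
    rw [← Scheme.Hom.comp_apply, cubeMap_forget, Scheme.Hom.comp_apply]
  ext x
  constructor
  · rintro ⟨s, hs, hx⟩
    have hr : x ∈ Set.range (cubeMap f f' j h (n + 1)) := by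
      have h1 : cubeForget f n i x ∈ Set.range (cubeMap f f' j h n) := ⟨s, hx⟩
      rw [range_cubeMap] at h1 ⊢
      rwa [Set.mem_preimage, ← Scheme.Hom.comp_apply, cubeForget_fst] at h1
    obtain ⟨x, rfl⟩ := hr
    refine ⟨x, ?_, rfl⟩
    rw [comm] at hx
    rwa [Set.mem_preimage, ← (cubeMap f f' j h n).isOpenEmbedding.injective hx]
  · rintro ⟨x, hx, rfl⟩
    exact ⟨_, hx, (comm x).symm⟩

/-- The value `0` inserted at `i` is arbitrary, since `i` is not among the constrained indices. The
codimension of the face is unchanged. -/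
theorem cubeForget_preimage_cubeFace (n : ℕ) (i : Fin (n + 1)) (s : Finset (Fin n))
    (ε : Fin n → Fin 2) :
    cubeForget f n i ⁻¹' cubeFace f n s ε =
      cubeFace f (n + 1) (s.map i.succAboveEmb) (i.insertNth (α := fun _ => Fin 2) 0 ε) := by
  ext x
  simp only [cubeFace, Set.mem_preimage, Set.mem_ofPred_eq, Finset.mem_map,
    forall_exists_index, and_imp, forall_apply_eq_imp_iff₂, Fin.succAboveEmb_apply,
    Fin.insertNth_apply_succAbove]
  refine forall₂_congr fun j _ => ?_
  rw [← Scheme.Hom.comp_apply, cubeForget_coord]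

variable [IsOpenImmersion j]

/-- A non-empty open subset of an irreducible space is dense, so `Z` is recovered from its
restriction. -/
theorem closure_image_preimage_cubeMap {n : ℕ} (Z : IrreducibleCloseds (cubeOver f n))
    (hZ : (cubeMap f f' j h n ⁻¹' (Z : Set (cubeOver f n))).Nonempty) :
    closure (cubeMap f f' j h n '' (cubeMap f f' j h n ⁻¹' (Z : Set (cubeOver f n)))) = Z := by
  rw [Set.image_preimage_eq_inter_range]
  refine (closure_minimal Set.inter_subset_left Z.isClosed).antisymm ?_
  refine subset_closure_inter_of_isPreirreducible_of_isOpen Z.isIrreducible.isPreirreducible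
    (cubeMap f f' j h n).isOpenEmbedding.isOpen_range ?_
  obtain ⟨x, hx⟩ := hZ
  exact ⟨_, hx, x, rfl⟩

variable [LocallyOfFiniteType f] {d : ℤ}

theorem Admissible.restrict_injective {n : ℕ} {Z₁ Z₂ : Admissible f d n}
    (h₁ : (cubeMap f f' j h n ⁻¹' (Z₁.1 : Set (cubeOver f n))).Nonempty)
    (h₂ : (cubeMap f f' j h n ⁻¹' (Z₂.1 : Set (cubeOver f n))).Nonempty)
    (e : Z₁.restrict f f' j h h₁ = Z₂.restrict f f' j h h₂) : Z₁ = Z₂ := by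
  have e' : cubeMap f f' j h n ⁻¹' (Z₁.1 : Set (cubeOver f n)) =
      cubeMap f f' j h n ⁻¹' (Z₂.1 : Set (cubeOver f n)) :=
    congrArg (fun Z : Admissible f' d n => (Z.1 : Set (cubeOver f' n))) e
  refine Subtype.ext (IrreducibleCloseds.ext ?_)
  rw [← closure_image_preimage_cubeMap f f' j h Z₁.1 h₁, e',
    closure_image_preimage_cubeMap f f' j h Z₂.1 h₂]

/-- If the restriction of an admissible `Z` to an open subscheme is degenerate, so is `Z`. -/
theorem IsDegenerate.of_restrict {n : ℕ} (Z : Admissible f d n)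
    (hZ : (cubeMap f f' j h n ⁻¹' (Z.1 : Set (cubeOver f n))).Nonempty)
    (hd : IsDegenerate f' d n (Z.restrict f f' j h hZ)) : IsDegenerate f d n Z := by
  match n, Z, hZ, hd with
  | n + 1, Z, hZ, ⟨i, Z', e⟩ =>
    have e : cubeMap f f' j h (n + 1) ⁻¹' (Z.1 : Set (cubeOver f (n + 1))) =
      cubeForget f' n i ⁻¹' (Z'.1 : Set (cubeOver f' n)) := e
    let j' := cubeMap f f' j h n
    -- The closure of `Z'` in `□ⁿ_Y` is the candidate whose pull-back is `Z`.
    let C : IrreducibleCloseds (cubeOver f n) := IrreducibleCloseds.map j' j'.continuous Z'.1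
    have hC : cubeForget f n i ⁻¹' (C : Set (cubeOver f n)) = Z.1 := by
      change cubeForget f n i ⁻¹' closure (j' '' Z'.1) = _
      rw [(isOpenMap_cubeForget f n i).preimage_closure_eq_closure_preimage
        (cubeForget f n i).continuous, cubeForget_preimage_image_cubeMap, ← e,
        closure_image_preimage_cubeMap f f' j h Z.1 hZ]
    have hC' : j' ⁻¹' (C : Set (cubeOver f n)) = Z'.1 := by
      change j' ⁻¹' closure (j' '' Z'.1) = _
      rw [← j'.isOpenEmbedding.isInducing.closure_eq_preimage_closure_image,
        Z'.1.isClosed.closure_eq]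
    have hdim := krullDim_preimage (cubeOverStr f n) j' C
      (by rw [hC']; exact Z'.1.isIrreducible.nonempty)
    rw [hC'] at hdim
    obtain ⟨r, hr, hr'⟩ := Z'.2.dim_eq
    obtain ⟨q, hq, hq'⟩ := Z.2.dim_eq
    have hqr : q = r + 1 := by push_cast at hq; omega
    refine ⟨i, ⟨C, ⟨r, hr, hdim.symm.trans hr'⟩, fun s ε => ?_⟩, hC.symm⟩
    -- For `T` the intersection of `C` with the face, `h1` and properness of `Z` give `dim T + 1 +
    -- s.card ≤ r + 1`; cancelling `1` yields properness of `C`.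
    have h1 := krullDim_preimage_cubeForget f n i (C.isClosed.inter (isClosed_cubeFace f n s ε))
    have h2 := Z.2.proper (s.map i.succAboveEmb) (i.insertNth (α := fun _ => Fin 2) 0 ε)
    rw [Set.preimage_inter, hC, cubeForget_preimage_cubeFace] at h1
    rw [Finset.card_map, hq', hqr] at h2
    rw [← hdim, hr']
    have h3 := (add_le_add_left h1 (s.card : WithBot ℕ∞)).trans h2
    rw [add_right_comm, Nat.cast_add, Nat.cast_one] at h3
    exact (ENat.WithBot.add_le_add_one_right_iff).1 h3

end AdmissibleRestriction

/-! ### Supported cycles in terms of coefficients -/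

section Cycles

variable {k : Type u} [Field k] {Y Y' : Scheme.{u}} (f : Y ⟶ Spec (.of k))
    (f' : Y' ⟶ Spec (.of k)) (j : Y' ⟶ Y) (h : j ≫ f = f') (d : ℤ) (n : ℕ)

theorem mem_degnCycles_iff (a : AdmCycles f d n) :
    a ∈ degnCycles f d n ↔ ∀ Z, ¬ IsDegenerate f d n Z → a Z = 0 := by
  constructor
  · intro ha Z hZ
    refine AddSubgroup.closure_induction (p := fun a _ => a Z = 0) ?_ rfl ?_ ?_ ha
    · rintro _ ⟨Z', hZ', rfl⟩
      exact Finsupp.single_eq_of_ne fun e => hZ (e ▸ hZ')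
    · intro a b _ _ ha hb
      rw [Finsupp.add_apply, ha, hb, add_zero]
    · intro a _ ha
      rw [Finsupp.neg_apply, ha, neg_zero]
  · intro ha
    rw [← Finsupp.sum_single a]
    refine sum_mem fun Z hZ => ?_
    have hd : IsDegenerate f d n Z :=
      by_contra fun hd => Finsupp.mem_support_iff.1 hZ (ha Z hd)
    have h1 : Finsupp.single Z (a Z) = a Z • Finsupp.single Z (1 : ℤ) := by
      rw [Finsupp.smul_single, smul_eq_mul, mul_one]
    rw [h1]
    have h2 : Finsupp.single Z (1 : ℤ) ∈ degnCycles f d n :=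
      AddSubgroup.subset_closure ⟨Z, hd, rfl⟩
    exact zsmul_mem h2 _

/-- The coefficients of a class in `z_d(Y, n)` at the non-degenerate admissible subschemes. -/
noncomputable def nondegenerateCoeff :
    HigherCycles f d n →+ ({Z : Admissible f d n // ¬ IsDegenerate f d n Z} →₀ ℤ) :=
  QuotientAddGroup.lift _ (Finsupp.subtypeDomainAddMonoidHom) fun a ha =>
    Finsupp.ext fun Z => (mem_degnCycles_iff f d n a).1 ha Z.1 Z.2

theorem nondegenerateCoeff_mk (a : AdmCycles f d n)
    (Z : {Z : Admissible f d n // ¬ IsDegenerate f d n Z}) :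
    nondegenerateCoeff f d n (QuotientAddGroup.mk a) Z = a Z.1 := rfl

theorem nondegenerateCoeff_surjective : Function.Surjective (nondegenerateCoeff f d n) := by
  classical
  intro g
  exact ⟨QuotientAddGroup.mk g.extendDomain, Finsupp.subtypeDomain_extendDomain g⟩

/-- The image in `Y` of the generic point of an admissible `Z`. -/
noncomputable def Admissible.basePoint {f : Y ⟶ Spec (.of k)} {d : ℤ} {n : ℕ}
    (Z : Admissible f d n) : Y :=
  pullback.fst f (cubeStr k n) Z.1.isIrreducible.genericPoint

variable [IsOpenImmersion j]

/-- An open set meets `Z` exactly when it contains the generic point of `Z`, and `□ⁿ_{Y'}` is the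
inverse image of the range of `j`. -/
theorem Admissible.nonempty_preimage_iff {d : ℤ} {n : ℕ} (Z : Admissible f d n) :
    (cubeMap f f' j h n ⁻¹' (Z.1 : Set (cubeOver f n))).Nonempty ↔
      Z.basePoint ∈ Set.range j := by
  have hZ := Z.1.isIrreducible.isGenericPoint_genericPoint Z.1.isClosed
  have h1 := hZ.mem_open_set_iff (cubeMap f f' j h n).isOpenEmbedding.isOpen_range
  rw [Set.inter_comm, Set.inter_nonempty_iff_exists_left] at h1
  have h2 : Z.basePoint ∈ Set.range j ↔
      Z.1.isIrreducible.genericPoint ∈ Set.range (cubeMap f f' j h n) := by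
    rw [range_cubeMap]; rfl
  rw [h2, h1]
  constructor
  · rintro ⟨x, hx⟩
    exact ⟨_, ⟨x, rfl⟩, hx⟩
  · rintro ⟨_, ⟨x, rfl⟩, hx⟩
    exact ⟨x, hx⟩

variable [LocallyOfFiniteType f]

/-- Distinct subschemes meeting `□ⁿ_{Y'}` have distinct restrictions, so coefficients never merge or
cancel. -/
theorem admRestrict_apply_restrict (a : AdmCycles f d n) (Z : Admissible f d n)
    (hZ : (cubeMap f f' j h n ⁻¹' (Z.1 : Set (cubeOver f n))).Nonempty) :
    admRestrict f f' j h d n a (Z.restrict f f' j h hZ) = a Z := by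
  classical
  induction a using Finsupp.induction_linear with
  | zero => rw [map_zero]; rfl
  | add a b ha hb => rw [map_add, Finsupp.add_apply, ha, hb, Finsupp.add_apply]
  | single Z' m =>
    rw [admRestrict, Finsupp.liftAddHom_apply_single]
    split_ifs with hZ'
    · rw [Finsupp.singleAddHom_apply, Finsupp.single_apply, Finsupp.single_apply]
      refine if_congr ⟨Admissible.restrict_injective f f' j h hZ' hZ, ?_⟩ rfl rfl
      rintro rfl
      rfl
    · have hne : Z ≠ Z' := by
        rintro rfl
        exact hZ' hZ
      rw [AddMonoidHom.zero_apply, Finsupp.single_eq_of_ne hne]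
      rfl

theorem exists_restrict_eq_of_admRestrict_ne_zero (a : AdmCycles f d n) (Z' : Admissible f' d n)
    (ha : admRestrict f f' j h d n a Z' ≠ 0) :
    ∃ (Z : Admissible f d n)
      (hZ : (cubeMap f f' j h n ⁻¹' (Z.1 : Set (cubeOver f n))).Nonempty),
      Z.restrict f f' j h hZ = Z' := by
  contrapose! ha
  induction a using Finsupp.induction_linear with
  | zero => rw [map_zero]; rfl
  | add a b ha hb => rw [map_add, Finsupp.add_apply, ha, hb, add_zero]
  | single Z m =>
    rw [admRestrict, Finsupp.liftAddHom_apply_single]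
    split_ifs with hZ
    · exact Finsupp.single_eq_of_ne (ha Z hZ).symm
    · rfl

/-- A subscheme meeting `□ⁿ_{Y'}` is degenerate if and only if its restriction is. Hence the
restricted cycle is degenerate precisely when the original has coefficient `0` at every
non-degenerate `Z` that survives. -/
theorem higherRestrict_eq_zero_iff (x : HigherCycles f d n) :
    higherRestrict f f' j h d n x = 0 ↔
      ∀ Z : {Z : Admissible f d n // ¬ IsDegenerate f d n Z},
        Z.1.basePoint ∈ Set.range j → nondegenerateCoeff f d n x Z = 0 := by
  obtain ⟨a, rfl⟩ := QuotientAddGroup.mk_surjective x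
  have h1 : higherRestrict f f' j h d n (QuotientAddGroup.mk a) =
    QuotientAddGroup.mk (admRestrict f f' j h d n a) := rfl
  rw [h1, QuotientAddGroup.eq_zero_iff, mem_degnCycles_iff]
  constructor
  · intro ha Z hZ
    rw [← Admissible.nonempty_preimage_iff f f' j h] at hZ
    rw [nondegenerateCoeff_mk, ← admRestrict_apply_restrict f f' j h d n a Z.1 hZ]
    exact ha _ fun hd => Z.2 (hd.of_restrict f f' j h Z.1 hZ)
  · intro ha Z' hZ'
    by_contra h0
    obtain ⟨Z, hZ, rfl⟩ := exists_restrict_eq_of_admRestrict_ne_zero f f' j h d n a Z' h0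
    refine h0 ?_
    rw [admRestrict_apply_restrict]
    -- The restriction of the basis cycle `Z` has coefficient `1` at `Z ∩ □ⁿ_{Y'}`; if it is a
    -- degenerate cycle, that subscheme must be degenerate.
    have hZd : ¬ IsDegenerate f d n Z := fun hd => hZ' <| by
      have h2 := degnCycles_le_comap f f' j h d n (AddSubgroup.subset_closure ⟨Z, hd, rfl⟩)
      rw [AddSubgroup.mem_comap, mem_degnCycles_iff] at h2
      by_contra hnd
      have h3 := h2 _ hnd
      rw [admRestrict_apply_restrict, Finsupp.single_eq_same] at h3
      exact one_ne_zero h3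
    exact ha ⟨Z, hZd⟩ ((Z.nonempty_preimage_iff f f' j h).1 hZ)

theorem mem_supportedCycles_compl_iff (U : Opens Y) (x : HigherCycles f d n) :
    x ∈ supportedCycles f d n U.compl ↔
      ∀ Z : {Z : Admissible f d n // ¬ IsDegenerate f d n Z},
        Z.1.basePoint ∈ U → nondegenerateCoeff f d n x Z = 0 := by
  rw [supportedCycles, AddMonoidHom.mem_ker, higherRestrict_eq_zero_iff]
  refine forall_congr' fun Z => ?_
  rw [Scheme.Opens.range_ι]
  simp

end Cycles

theorem proposition4p4 {k : Type u} [Field k] {Y : Scheme.{u}} (f : Y ⟶ Spec (.of k))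
    [LocallyOfFiniteType f] [QuasiCompact f] (d : ℤ) (n : ℕ) :
    (cyclePresheaf f d n).IsSheaf ∧ (cyclePresheaf f d n).IsFlasque ∧
      ∀ U V : Y.Opens,
        Function.Injective (mayerVietorisZero (cyclePresheaf f d n) U V) ∧
        Function.Exact (mayerVietorisZero (cyclePresheaf f d n) U V)
          (mayerVietorisOne (cyclePresheaf f d n) U V) ∧
        Function.Surjective (mayerVietorisOne (cyclePresheaf f d n) U V) := by
  -- Finite type over a field makes `Y` a Noetherian space, which the sheaf property needs in order
  -- to glue infinite covers.
  have : IsLocallyNoetherian Y := LocallyOfFiniteType.isLocallyNoetherian f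
  have : CompactSpace Y := QuasiCompact.compactSpace_of_compactSpace f
  have : IsNoetherian Y := {}
  have : NoetherianSpace Y := inferInstance
  have hc := nondegenerateCoeff_surjective f d n
  have hy := mem_supportedCycles_compl_iff f d n
  exact ⟨quotientPresheaf_isSheaf _ _ _ _ hc hy, quotientPresheaf_isFlasque _ _,
    quotientPresheaf_mayerVietoris _ _ _ _ hc hy⟩
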